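/- **Theorem (First Fundamental Theorem of Calculus, point-free).** Spaces are locales, maps are locale maps (so every map is continuous), and real numbers are Dedekind reals. Notation and definitions: - For reals $x\le y$, the Lebesgue valuation $\lambda_{xy}$ on $[x,y]$ is the valuation with $\lambda_{xy}(a,b)=\max(0,\min(b,y)-\max(a,x))$ for all rationals $a<b$. The uniform valuation $\upsilon_{xy}$ on $[x,y]$ is the valuation for which, for rationals $a<b$ and $q\ge 0$, $q<\upsilon_{xy}(a,b)$ iff $q'(y-x)<\lambda_{xy}(a,b)$ or ($a<x$, $y<b$ and $q'<1$) for some rational $q'>q$. The mass of a general open is the supremum of the total masses of the finite families of pairwise disjoint rational open intervals contained in it (relative to $[x,y]$). - For a finite valuation $\mu$ on a compact space $X$ and a map $\varphi\colon X\to[0,\infty)$, the integral $\int_X\varphi\,d\mu$ is the Dedekind real whose lower part is the lower integral $\sup\sum_{i=1}^n(r_i-r_{i-1})\,\mu\bigl(\varphi^*(r_i,\infty)\bigr)$ and whose upper part is the upper integral $\inf\sum_{i=1}^n(r_i-r_{i-1})\bigl(\mu X-\mu\,\varphi^*[0,r_{i-1})\bigr)$; both range over the rational sequences $0=r_0<\dots<r_n$,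 $n\ge1$, for the upper integral only those with $\varphi^*[0,r_n)=X$. For $\varphi\colon X\to\mathbb R$, $\int_X\varphi\,d\mu=\int_X\max(0,\varphi)\,d\mu-\int_X\max(0,-\varphi)\,d\mu$. - $\int_x^y g(t)\,dt$ is $\int_{[x,y]}g\,d\lambda_{xy}$ if $x\le y$, and $-\int_{[y,x]}g\,d\lambda_{yx}$ if $y\le x$. - A map $f\colon I\to\mathbb R$ on an open interval $I$ is differentiable (in the sense of Carathéodory) with derivative $f'$ if there is a map $f^{\langle1\rangle}\colon I\times I\to\mathbb R$ (a slope map) such that, as maps on $I\times I$, $f(y)-f(x)=(y-x)\,f^{\langle1\rangle}(x,y)$, and $f'(x)=f^{\langle1\rangle}(x,x)$. Let $I$ be an open interval of $\mathbb R$ (bounded or not), $x_0$ a point of $I$, and $g\colon I\to\mathbb R$ a map. Then $f(x)=\int_{x_0}^x g(t)\,dt$ defines a unique map $f\colon I\to\mathbb R$, and $f$ is differentiable in the sense of Carathéodory with derivative $f'=g$. A slope map is given, uniformly for all points $x,y$ of $I$ (including $x=y$), by $$f^{\langle1\rangle}(x,y)=\int_{[x',y']}g\,d\upsilon_{x'y'},\qquad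 x'=\min(x,y),\quad y'=\max(x,y),$$ where $\upsilon_{x'y'}$ is a probability valuation and the integral exists as a Dedekind real. -/

import Mathlib

open TopologicalSpace
open scoped NNReal ENNReal

noncomputable section

namespace PointFree

/-! Point-free spaces (locales) and their maps. A map `X → Y` is a frame homomorphism from the
frame of opens of `Y` to the frame of opens of `X` (its inverse image). The locales of concern here,
namely the real line, its intervals and their finite products, are spatial and locally compact:
their frames are the lattices `Opens` of the corresponding topological spaces, and the product
space is the product locale. -/

/-- Maps of point-free spaces from `X` to `Y`, given by their inverse images on opens. -/
abbrev LMap (X Y : Type) [TopologicalSpace X] [TopologicalSpace Y] : Type :=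
  FrameHom (Opens Y) (Opens X)

/-- The map `f` takes the point `x` to the point `y`. -/
def LMap.HasValue {X Y : Type} [TopologicalSpace X] [TopologicalSpace Y]
    (f : LMap X Y) (x : X) (y : Y) : Prop :=
  ∀ U : Opens Y, x ∈ f U ↔ y ∈ U

/-- The composite `L → ℝ × ℝ → ℝ` of the pairing of two maps `u, v` from a locale with frame of
opens `L` to the reals with a binary operation `op` on the reals. It is given by its inverse
image: the inverse image of `A × B` under the pairing is `u A ⊓ v B`. -/
def binop {L : Type} [Order.Frame L] (op : C(ℝ × ℝ, ℝ)) (u v : Opens ℝ → L) (U : Opens ℝ) : L :=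
  ⨆ (A : Opens ℝ) (B : Opens ℝ) (_ : ∀ a ∈ A, ∀ b ∈ B, op (a, b) ∈ U), u A ⊓ v B

/-- Subtraction as a map. -/
def subMap : C(ℝ × ℝ, ℝ) := ⟨fun p => p.1 - p.2, by fun_prop⟩

/-- Multiplication as a map. -/
def mulMap : C(ℝ × ℝ, ℝ) := ⟨fun p => p.1 * p.2, by fun_prop⟩

/-! Differentiation in the sense of Carathéodory, on an open `I` of the real line. -/

/-- `s` is a slope map for `f`: as maps `I × I → ℝ` in the variables `(x, y)`,
`f(y) - f(x) = (y - x) s(x, y)`. -/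
def IsSlope {I : Opens ℝ} (f : LMap I ℝ) (s : LMap (I × I) ℝ) : Prop :=
  binop subMap ((Opens.comap (ContinuousMap.snd : C(I × I, I))).comp f)
      ((Opens.comap (ContinuousMap.fst : C(I × I, I))).comp f) =
    binop mulMap
      (binop subMap (Opens.comap (⟨fun p => (p.2 : ℝ), by fun_prop⟩ : C(I × I, ℝ)))
        (Opens.comap (⟨fun p => (p.1 : ℝ), by fun_prop⟩ : C(I × I, ℝ))))
      s

/-- The restriction `x ↦ s(x, x)` of a map on `I × I` to the diagonal. -/
def diagonal {I : Opens ℝ} (s : LMap (I × I) ℝ) : LMap I ℝ :=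
  (Opens.comap ((ContinuousMap.id I).prodMk (ContinuousMap.id I))).comp s

/-- `f` is differentiable with derivative `f'` (in the sense of Carathéodory), and this is
witnessed by the slope map `s`. -/
def HasDerivativeVia {I : Opens ℝ} (f f' : LMap I ℝ) (s : LMap (I × I) ℝ) : Prop :=
  IsSlope f s ∧ diagonal s = f'

/-! Valuations and integrals on a locale with frame of opens `L`. Non-negative lower and upper
reals are elements of `ℝ≥0∞`. -/

section Integration

variable {L : Type} [Order.Frame L]

/-- Valuations: Scott continuous, strict and modular. -/
structure IsValuation (μ : L → ℝ≥0∞) : Prop where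
  scott : ScottContinuous μ
  map_bot : μ ⊥ = 0
  modular : ∀ U V : L, μ U + μ V = μ (U ⊔ V) + μ (U ⊓ V)

/-- Probability valuations. -/
structure IsProbabilityValuation (μ : L → ℝ≥0∞) : Prop extends IsValuation μ where
  map_top : μ ⊤ = 1

/-- The complement covaluation of a finite valuation: the mass of closed complements. -/
def compl (μ : L → ℝ≥0∞) (U : L) : ℝ≥0∞ := μ ⊤ - μ U

/-- Rational sequences `0 = r 0 < r 1 < ⋯ < r n`, with `1 ≤ n`. (The values of `r` after `n` are
irrelevant.) -/
def IsSubdivision (n : ℕ) (r : ℕ → ℚ≥0) : Prop :=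
  1 ≤ n ∧ r 0 = 0 ∧ ∀ i < n, r i < r (i + 1)

/-- The open `(q, ∞)` of `[0, ∞)`. -/
def above (q : ℚ≥0) : Opens ℝ≥0 := ⟨Set.Ioi (q : ℝ≥0), isOpen_Ioi⟩

/-- The open `[0, q)` of `[0, ∞)`. -/
def below (q : ℚ≥0) : Opens ℝ≥0 := ⟨Set.Iio (q : ℝ≥0), isOpen_Iio⟩

/-- The length `r (i + 1) - r i` of a step of a subdivision. -/
def step (r : ℕ → ℚ≥0) (i : ℕ) : ℝ≥0∞ := ((r (i + 1) : ℝ≥0) - (r i : ℝ≥0) : ℝ≥0)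

/-- The lower integral of (the lower part of) a map `φ` to `[0, ∞)` against a valuation. -/
def lowerIntegral (μ : L → ℝ≥0∞) (φ : FrameHom (Opens ℝ≥0) L) : ℝ≥0∞ :=
  ⨆ (n : ℕ) (r : ℕ → ℚ≥0) (_ : IsSubdivision n r),
    ∑ i ∈ Finset.range n, step r i * μ (φ (above (r (i + 1))))

/-- The upper integral of (the upper part of) a map `φ` to `[0, ∞)` against a covaluation. -/
def upperIntegral (ν : L → ℝ≥0∞) (φ : FrameHom (Opens ℝ≥0) L) : ℝ≥0∞ :=
  ⨅ (n : ℕ) (r : ℕ → ℚ≥0) (_ : IsSubdivision n r) (_ : φ (below (r n)) = ⊤),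
    ∑ i ∈ Finset.range n, step r i * ν (φ (below (r i)))

/-- The two-sided integral of a map `φ` to `[0, ∞)` is the (Dedekind) real `a`: the pair formed by
the lower integral against `μ` and the upper integral against the complement of `μ` is the
pair of the lower part and the upper part of `a`. -/
def IsIntegralNonneg (μ : L → ℝ≥0∞) (φ : FrameHom (Opens ℝ≥0) L) (a : ℝ≥0) : Prop :=
  lowerIntegral μ φ = a ∧ upperIntegral (compl μ) φ = a

/-- The positive part `max 0 φ` of a real-valued map. -/
def posPart (φ : FrameHom (Opens ℝ) L) : FrameHom (Opens ℝ≥0) L :=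
  φ.comp (Opens.comap ⟨fun t : ℝ => Real.toNNReal t, by fun_prop⟩)

/-- The negative part `max 0 (-φ)` of a real-valued map. -/
def negPart (φ : FrameHom (Opens ℝ) L) : FrameHom (Opens ℝ≥0) L :=
  φ.comp (Opens.comap ⟨fun t : ℝ => Real.toNNReal (-t), by fun_prop⟩)

/-- The two-sided integral of the real-valued map `φ` against `μ` exists and equals `a`. -/
def IsIntegral (μ : L → ℝ≥0∞) (φ : FrameHom (Opens ℝ) L) (a : ℝ) : Prop :=
  ∃ p n : ℝ≥0, IsIntegralNonneg μ (posPart φ) p ∧ IsIntegralNonneg μ (negPart φ) n ∧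
    a = (p : ℝ) - (n : ℝ)

end Integration

/-! Valuations on the compact interval `[x, y]`. -/

/-- The trace on `[x, y]` of the rational open interval `(a, b)`. -/
def trace (x y : ℝ) (a b : ℚ) : Opens (Set.Icc x y) :=
  ⟨{t | (a : ℝ) < t ∧ (t : ℝ) < b},
    (isOpen_lt continuous_const continuous_subtype_val).inter
      (isOpen_lt continuous_subtype_val continuous_const)⟩

/-- Extension to all opens of `[x, y]` of a mass function `m` on rational open intervals: the mass
of `U` is the supremum of the total masses of the finite families of pairwise disjoint rational
open intervals with trace contained in `U`. -/
def extend (x y : ℝ) (m : ℚ → ℚ → ℝ≥0∞) (U : Opens (Set.Icc x y)) : ℝ≥0∞ :=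
  ⨆ (S : Finset (ℚ × ℚ)) (_ : ∀ p ∈ S, p.1 < p.2 ∧ trace x y p.1 p.2 ≤ U)
    (_ : (S : Set (ℚ × ℚ)).PairwiseDisjoint (fun p => Set.Ioo p.1 p.2)),
    ∑ p ∈ S, m p.1 p.2

/-- The Lebesgue mass of `(a, b)` in `[x, y]`: the truncated difference of `min b y` and
`max a x`. -/
def lebesgueMass (x y : ℝ) (a b : ℚ) : ℝ≥0∞ :=
  ENNReal.ofReal (min (b : ℝ) y - max (a : ℝ) x)

/-- The Lebesgue valuation on `[x, y]`. -/
def lebesgue (x y : ℝ) : Opens (Set.Icc x y) → ℝ≥0∞ :=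
  extend x y (lebesgueMass x y)

/-- The uniform mass of `(a, b)` in `[x, y]`, for `x ≤ y`: the lower real whose non-negative rational
lower bounds are the `q` with `q (y - x) < λ(a, b)` or (`a < x`, `y < b` and `q < 1`). -/
def uniformMass (x y : ℝ) (a b : ℚ) : ℝ≥0∞ :=
  ⨆ (q : ℚ≥0) (_ : ((q : ℝ≥0) : ℝ≥0∞) * ENNReal.ofReal (y - x) < lebesgueMass x y a b ∨
      ((a : ℝ) < x ∧ y < b ∧ q < 1)), ((q : ℝ≥0) : ℝ≥0∞)

/-- The uniform probability valuation on `[x, y]`, including the case `x = y`. -/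
def uniform (x y : ℝ) : Opens (Set.Icc x y) → ℝ≥0∞ :=
  extend x y (uniformMass x y)

/-! Integrals of maps on an open interval `I`. -/

/-- The inclusion `[x, y] → I`, for points `x, y` of an interval `I`. -/
def inclusion {I : Opens ℝ} (hI : (I : Set ℝ).OrdConnected) (x y : I) :
    C(Set.Icc (x : ℝ) (y : ℝ), I) :=
  ⟨fun t => ⟨t, hI.out x.2 y.2 t.2⟩, by fun_prop⟩

/-- The restriction of a map on `I` to `[x, y]`. -/
def restrict {I : Opens ℝ} (hI : (I : Set ℝ).OrdConnected) (g : LMap I ℝ) (x y : I) :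
    LMap (Set.Icc (x : ℝ) (y : ℝ)) ℝ :=
  (Opens.comap (inclusion hI x y)).comp g

/-- The Riemann integral of `g` from `x` to `y` exists and equals `a`. It is the integral against the
Lebesgue valuation on `[x, y]` if `x ≤ y`, and the negative of that on `[y, x]` if `y ≤ x`. -/
def IsRiemannIntegral {I : Opens ℝ} (hI : (I : Set ℝ).OrdConnected) (g : LMap I ℝ) (x y : I)
    (a : ℝ) : Prop :=
  (x ≤ y → IsIntegral (lebesgue x y) (restrict hI g x y) a) ∧
    (y ≤ x → IsIntegral (lebesgue y x) (restrict hI g y x) (-a))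

/-- `f` is given on `I` by `f(x) = ∫_{x₀}^x g(t) dt`. -/
def IsIndefiniteIntegral {I : Opens ℝ} (hI : (I : Set ℝ).OrdConnected) (g : LMap I ℝ) (x₀ : I)
    (f : LMap I ℝ) : Prop :=
  ∀ x : I, ∃ a : ℝ, IsRiemannIntegral hI g x₀ x a ∧ f.HasValue x a

end PointFree

end

/-! The real line is sober, so every map in sight is the inverse image of a continuous function, and
identities between maps may be checked at points (`LMap.exists_eq_comap`, `binop_comap`). Both
valuations are traces of Borel measures on opens: `lebesgue` of Lebesgue measure, `uniform` of
normalised Lebesgue measure if `x < y` and of a Dirac measure if `x = y`. On a compact space, the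
two-sided integral against such a trace of a finite measure is the ordinary integral
(`isIntegral_comap_iff`).

By substitution, the uniform integral is `∫₀¹ G(x + (y - x)t) dt`, a formula that makes no
distinction between `x < y` and `x = y`. It is jointly continuous, symmetric in `x` and `y`, equal
to `G x` on the diagonal, and its product with `y - x` is `∫_x^y G`. It is therefore a slope map for
the indefinite integral, with derivative `G`. -/

namespace PointFree

open MeasureTheory

/-! ### Locale maps as continuous functions -/

section Maps

variable {X Y : Type} [TopologicalSpace X] [TopologicalSpace Y]

/-- The opens whose inverse image misses `x` have a largest member `V`. Preservation of the top and
of binary meets makes the complement of `V` irreducible, and its generic point is the value. -/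
theorem LMap.exists_hasValue [QuasiSober Y] (f : LMap X Y) (x : X) : ∃ y, f.HasValue x y := by
  let V : Opens Y := sSup {U | x ∉ f U}
  have hV : x ∉ f V := by
    simp only [V, map_sSup]
    intro h
    obtain ⟨W, hW, hx⟩ := Opens.mem_sSup.1 h
    obtain ⟨U, hU, rfl⟩ := hW
    exact hU hx
  have key : ∀ U : Opens Y, x ∉ f U ↔ U ≤ V := fun U =>
    ⟨fun h => le_sSup h, fun h hx => hV (OrderHomClass.mono f h hx)⟩
  have hirr : IsIrreducible ((V : Set Y)ᶜ) := by
    refine ⟨?_, ?_⟩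
    · rw [Set.nonempty_compl]
      intro h
      have : V = ⊤ := Opens.ext h
      rw [this, map_top] at hV
      exact hV trivial
    · rintro A B hA hB ⟨a, haV, ha⟩ ⟨b, hbV, hb⟩
      have h1 : x ∈ f ⟨A, hA⟩ := by
        by_contra h
        exact haV ((key _).1 h ha)
      have h2 : x ∈ f ⟨B, hB⟩ := by
        by_contra h
        exact hbV ((key _).1 h hb)
      by_contra hne
      have h3 : (⟨A, hA⟩ ⊓ ⟨B, hB⟩ : Opens Y) ≤ V := by
        intro c hc
        by_contra hcV
        exact hne ⟨c, hcV, hc⟩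
      refine (key _).2 h3 ?_
      rw [map_inf]
      exact ⟨h1, h2⟩
  obtain ⟨y, hy⟩ := QuasiSober.sober hirr V.isOpen.isClosed_compl
  refine ⟨y, fun U => ?_⟩
  have h1 := hy.mem_open_set_iff U.isOpen
  rw [← not_iff_not, key U]
  change _ ↔ y ∉ (U : Set Y)
  rw [h1, Set.not_nonempty_iff_eq_empty, ← Set.disjoint_iff_inter_eq_empty,
    Set.disjoint_compl_left_iff_subset]
  rfl

theorem LMap.exists_eq_comap [QuasiSober Y] (f : LMap X Y) :
    ∃ F : C(X, Y), f = Opens.comap F := by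
  choose F hF using f.exists_hasValue
  have h : ∀ U : Opens Y, F ⁻¹' U = f U := fun U => Set.ext fun x => (hF x U).symm
  refine ⟨⟨F, ⟨fun s hs => ?_⟩⟩, ?_⟩
  · have := h ⟨s, hs⟩
    exact this ▸ (f ⟨s, hs⟩).isOpen
  · refine FrameHom.ext fun U => Opens.ext ?_
    exact (h U).symm

theorem hasValue_comap_iff [T0Space Y] (F : C(X, Y)) (x : X) (y : Y) :
    LMap.HasValue (Opens.comap F) x y ↔ F x = y := by
  refine ⟨fun h => ?_, fun h U => by rw [← h]; rfl⟩
  by_contra hne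
  obtain ⟨U, hU, hx⟩ := exists_isOpen_xor_mem hne
  have := h ⟨U, hU⟩
  change F x ∈ U ↔ y ∈ U at this
  rcases hx with ⟨h1, h2⟩ | ⟨h1, h2⟩
  · exact h2 (this.1 h1)
  · exact h2 (this.2 h1)

theorem binop_comap (op : C(ℝ × ℝ, ℝ)) (u v : C(X, ℝ)) :
    binop op (Opens.comap u) (Opens.comap v) = Opens.comap (op.comp (u.prodMk v)) := by
  funext U
  ext x
  simp only [binop, SetLike.mem_coe, Opens.mem_iSup]
  constructor
  · rintro ⟨A, B, h, hu, hv⟩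
    exact h _ hu _ hv
  · intro h
    have hU : IsOpen (op ⁻¹' (U : Set ℝ)) := U.isOpen.preimage op.continuous
    obtain ⟨A, B, hA, hB, ha, hb, hAB⟩ := isOpen_prod_iff.1 hU (u x) (v x) h
    exact ⟨⟨A, hA⟩, ⟨B, hB⟩, fun a ha b hb => hAB (Set.mk_mem_prod ha hb), ha, hb⟩

end Maps

/-! ### Pointwise estimates for lower and upper sums -/

section Subdivisions

/-- This and the next three bounds are the pointwise form of the integral sums at a point where the
integrand equals `t`; integrating them compares the sums with the integral. -/
theorem lower_sum_le_min (r : ℕ → ℝ≥0) (t : ℝ≥0) (n : ℕ) (h0 : r 0 = 0)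
    (hr : ∀ i < n, r i ≤ r (i + 1)) :
    ∑ i ∈ Finset.range n, (if r (i + 1) < t then r (i + 1) - r i else 0) ≤ min t (r n) := by
  induction n with
  | zero => simp [h0]
  | succ n ih =>
    rw [Finset.sum_range_succ]
    have ih := ih fun i hi => hr i (hi.trans n.lt_succ_self)
    obtain ⟨d, hd⟩ := exists_add_of_le (hr n n.lt_succ_self)
    rw [hd, add_tsub_cancel_left]
    split_ifs with h
    · rw [min_eq_right h.le]
      gcongr
      exact ih.trans (min_le_right _ _)
    · rw [add_zero]
      exact ih.trans (min_le_min le_rfl le_self_add)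

theorem min_le_upper_sum (r : ℕ → ℝ≥0) (t : ℝ≥0) (n : ℕ) (h0 : r 0 = 0)
    (hr : ∀ i < n, r i ≤ r (i + 1)) :
    min t (r n) ≤ ∑ i ∈ Finset.range n, (if r i ≤ t then r (i + 1) - r i else 0) := by
  induction n with
  | zero => simp [h0]
  | succ n ih =>
    rw [Finset.sum_range_succ]
    have ih := ih fun i hi => hr i (hi.trans n.lt_succ_self)
    obtain ⟨d, hd⟩ := exists_add_of_le (hr n n.lt_succ_self)
    rw [hd, add_tsub_cancel_left]
    split_ifs with h
    · rw [min_eq_right h] at ih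
      exact (min_le_right _ _).trans (by gcongr)
    · rw [min_eq_left (not_le.1 h).le] at ih
      rw [add_zero]
      exact (min_le_left _ _).trans ih

theorem min_le_lower_sum_add (r : ℕ → ℝ≥0) (ε t : ℝ≥0) (n : ℕ) (h0 : r 0 = 0)
    (hr : ∀ i < n, r i ≤ r (i + 1)) (hε : ∀ i < n, r (i + 1) ≤ r i + ε) :
    min t (r n) ≤
      ∑ i ∈ Finset.range n, (if r (i + 1) < t then r (i + 1) - r i else 0) + ε := by
  -- The first conjunct says that nothing is lost before the subdivision reaches `t`. Only the
  -- crossing step then costs anything, at most `ε`.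
  suffices (r n < t →
      r n ≤ ∑ i ∈ Finset.range n, (if r (i + 1) < t then r (i + 1) - r i else 0)) ∧
      min t (r n) ≤
      ∑ i ∈ Finset.range n, (if r (i + 1) < t then r (i + 1) - r i else 0) + ε from this.2
  induction n with
  | zero => simp [h0]
  | succ n ih =>
    rw [Finset.sum_range_succ]
    have ih := ih (fun i hi => hr i (hi.trans n.lt_succ_self))
      (fun i hi => hε i (hi.trans n.lt_succ_self))
    have hle := hr n n.lt_succ_self
    have hεn := hε n n.lt_succ_self
    obtain ⟨d, hd⟩ := exists_add_of_le hle
    by_cases h : r (n + 1) < t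
    · have h1 := ih.1 (hle.trans_lt h)
      rw [if_pos h, hd, add_tsub_cancel_left]
      have h2 : r n + d ≤ ∑ i ∈ Finset.range n,
          (if r (i + 1) < t then r (i + 1) - r i else 0) + d := by gcongr
      exact ⟨fun _ => h2, (min_le_right _ _).trans (h2.trans le_self_add)⟩
    · refine ⟨fun h' => absurd h' h, ?_⟩
      rw [if_neg h, add_zero]
      by_cases h' : r n < t
      · refine (min_le_right _ _).trans (hεn.trans ?_)
        gcongr
        exact ih.1 h'
      · refine (min_le_left _ _).trans ?_
        simpa [min_eq_left (not_lt.1 h')] using ih.2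

theorem upper_sum_le_add (r : ℕ → ℝ≥0) (ε t : ℝ≥0) (n : ℕ)
    (hr : ∀ i < n, r i ≤ r (i + 1)) (hε : ∀ i < n, r (i + 1) ≤ r i + ε) :
    ∑ i ∈ Finset.range n, (if r i ≤ t then r (i + 1) - r i else 0) ≤ t + ε := by
  -- The bound by `r n` carries the induction: if `r n ≤ t`, the new sum is at most `r (n + 1) ≤ r n
  -- + ε ≤ t + ε`.
  suffices ∑ i ∈ Finset.range n, (if r i ≤ t then r (i + 1) - r i else 0) ≤
      min (r n) (t + ε) from this.trans (min_le_right _ _)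
  induction n with
  | zero => simp
  | succ n ih =>
    rw [Finset.sum_range_succ]
    have ih := ih (fun i hi => hr i (hi.trans n.lt_succ_self))
      (fun i hi => hε i (hi.trans n.lt_succ_self))
    have hεn := hε n n.lt_succ_self
    obtain ⟨d, hd⟩ := exists_add_of_le (hr n n.lt_succ_self)
    split_ifs with h
    · have h2 : ∑ i ∈ Finset.range n, (if r i ≤ t then r (i + 1) - r i else 0) +
          (r (n + 1) - r n) ≤ r (n + 1) := by
        rw [hd, add_tsub_cancel_left]
        gcongr
        exact ih.trans (min_le_left _ _)
      exact le_min h2 (h2.trans (hεn.trans (by gcongr)))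
    · rw [add_zero]
      exact ih.trans (min_le_min (hr n n.lt_succ_self) le_rfl)

end Subdivisions

/-! ### Two-sided integrals against measures -/

section Integrals

variable {X : Type} [TopologicalSpace X] [MeasurableSpace X] [BorelSpace X]

/-- The restriction of a measure to the frame of opens. -/
def openMass (μ : Measure X) (U : Opens X) : ℝ≥0∞ := μ U

/-- Scott continuity comes from inner regularity: a compact set inside a directed union of opens
already lies in one of them. -/
theorem isValuation_openMass (μ : Measure X) [μ.Regular] : IsValuation (openMass μ) where
  scott := by
    intro d hne hd a ha
    obtain rfl : sSup d = a := (isLUB_sSup d).unique ha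
    refine ⟨?_, fun b hb => ?_⟩
    · rintro _ ⟨U, hU, rfl⟩
      exact measure_mono (le_sSup hU : U ≤ sSup d)
    · refine le_of_forall_lt fun c hc => ?_
      obtain ⟨K, hK, hKc, hcK⟩ := (sSup d).isOpen.exists_lt_isCompact hc
      have : Nonempty d := hne.to_subtype
      obtain ⟨U, hU⟩ := hKc.elim_directed_cover (fun U : d => (U : Set X))
        (fun U => U.1.isOpen) (fun x hx => by simpa using hK hx)
        (fun U V => by
          obtain ⟨W, hW, hUW, hVW⟩ := hd U U.2 V V.2
          exact ⟨⟨W, hW⟩, hUW, hVW⟩)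
      exact hcK.trans_le ((measure_mono hU).trans (hb ⟨U, U.2, rfl⟩))
  map_bot := by simp [openMass]
  modular U V := (measure_union_add_inter _ V.isOpen.measurableSet).symm

theorem exists_uniform_subdivision (M ε : ℝ≥0) (hε : 0 < ε) :
    ∃ (n : ℕ) (r : ℕ → ℚ≥0), IsSubdivision n r ∧ M < (r n : ℝ≥0) ∧
      ∀ i, (r (i + 1) : ℝ≥0) ≤ r i + ε := by
  obtain ⟨N, hN⟩ := exists_nat_one_div_lt (NNReal.coe_pos.2 hε)
  obtain ⟨m, hm⟩ := exists_nat_gt (M * (N + 1))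
  refine ⟨m + 1, fun i => i / (N + 1), ⟨by omega, by simp, fun i _ => ?_⟩, ?_, fun i => ?_⟩
  · push_cast
    gcongr
    simp
  · push_cast
    rw [lt_div_iff₀ (by positivity)]
    exact hm.trans (by simp)
  · push_cast
    rw [add_div]
    gcongr
    exact_mod_cast hN.le

variable (μ : Measure X) (h : C(X, ℝ≥0))

theorem lower_sum_eq_lintegral (n : ℕ) (r : ℕ → ℚ≥0) :
    ∑ i ∈ Finset.range n, step r i * openMass μ (Opens.comap h (above (r (i + 1)))) =
      ∫⁻ x, ((∑ i ∈ Finset.range n, (if (r (i + 1) : ℝ≥0) < h x then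
        (r (i + 1) : ℝ≥0) - r i else 0) : ℝ≥0) : ℝ≥0∞) ∂μ := by
  have hm : ∀ i, MeasurableSet {x | (r (i + 1) : ℝ≥0) < h x} := fun i =>
    (isOpen_lt continuous_const h.continuous).measurableSet
  simp_rw [ENNReal.ofNNReal_finsetSum]
  rw [lintegral_finsetSum]
  · refine Finset.sum_congr rfl fun i _ => ?_
    rw [step]
    refine (lintegral_indicator_const (hm i) _).symm.trans (lintegral_congr fun x => ?_)
    simp only [Set.indicator, Set.mem_ofPred_eq]
    split_ifs <;> simp
  · intro i _
    exact (Measurable.ite (hm i) measurable_const measurable_const).coe_nnreal_ennreal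

theorem upper_sum_eq_lintegral [IsFiniteMeasure μ] (n : ℕ) (r : ℕ → ℚ≥0) :
    ∑ i ∈ Finset.range n, step r i * compl (openMass μ) (Opens.comap h (below (r i))) =
      ∫⁻ x, ((∑ i ∈ Finset.range n, (if (r i : ℝ≥0) ≤ h x then
        (r (i + 1) : ℝ≥0) - r i else 0) : ℝ≥0) : ℝ≥0∞) ∂μ := by
  have hm : ∀ i, MeasurableSet {x | (r i : ℝ≥0) ≤ h x} := fun i =>
    (isClosed_le continuous_const h.continuous).measurableSet
  simp_rw [ENNReal.ofNNReal_finsetSum]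
  rw [lintegral_finsetSum]
  · refine Finset.sum_congr rfl fun i _ => ?_
    have hc : compl (openMass μ) (Opens.comap h (below (r i))) = μ {x | (r i : ℝ≥0) ≤ h x} := by
      rw [compl, openMass, openMass, Opens.coe_top,
        ← measure_compl (Opens.isOpen _).measurableSet (measure_ne_top _ _)]
      congr 1
      ext x
      exact not_lt (a := h x)
    rw [hc, step]
    refine (lintegral_indicator_const (hm i) _).symm.trans (lintegral_congr fun x => ?_)
    simp only [Set.indicator, Set.mem_ofPred_eq]
    split_ifs <;> simp
  · intro i _
    exact (Measurable.ite (hm i) measurable_const measurable_const).coe_nnreal_ennreal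

theorem IsSubdivision.cast_zero {n : ℕ} {r : ℕ → ℚ≥0} (hr : IsSubdivision n r) :
    (r 0 : ℝ≥0) = 0 := by simp [hr.2.1]

theorem IsSubdivision.cast_le {n : ℕ} {r : ℕ → ℚ≥0} (hr : IsSubdivision n r) (i : ℕ)
    (hi : i < n) : (r i : ℝ≥0) ≤ r (i + 1) := by exact_mod_cast (hr.2.2 i hi).le

theorem le_of_forall_pos_le_add_mul {a b c : ℝ≥0∞} (hc : c ≠ ∞)
    (hab : ∀ ε : ℝ≥0, 0 < ε → a ≤ b + ε * c) : a ≤ b := by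
  refine ENNReal.le_of_forall_pos_le_add fun δ hδ _ => ?_
  lift c to ℝ≥0 using hc
  -- Division is by `c + 1` because `c` may be zero.
  refine (hab (δ / (c + 1)) (by positivity)).trans ?_
  gcongr
  rw [← ENNReal.coe_mul]
  refine ENNReal.coe_le_coe.2 ?_
  rw [div_mul_eq_mul_div]
  exact div_le_of_le_mul₀ (by positivity) (by positivity) (by gcongr; exact le_self_add)

/-- Compactness bounds `h` by some `M`; a subdivision beyond `M` of mesh at most `ε` then has error
at most `ε` times the total mass. -/
theorem lowerIntegral_comap [IsFiniteMeasure μ] [CompactSpace X] :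
    lowerIntegral (openMass μ) (Opens.comap h) = ∫⁻ x, h x ∂μ := by
  apply le_antisymm
  · refine iSup_le fun n => iSup_le fun r => iSup_le fun hr => ?_
    rw [lower_sum_eq_lintegral]
    refine lintegral_mono fun x => ENNReal.coe_le_coe.2 ?_
    exact (lower_sum_le_min (fun i => (r i : ℝ≥0)) _ n hr.cast_zero hr.cast_le).trans
      (min_le_left _ _)
  · obtain ⟨M, hM⟩ := (isCompact_range h.continuous).bddAbove
    refine le_of_forall_pos_le_add_mul (measure_ne_top μ Set.univ) fun ε hε => ?_
    obtain ⟨n, r, hr, hn, hs⟩ := exists_uniform_subdivision M ε hε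
    have h1 : ∑ i ∈ Finset.range n, step r i * openMass μ (Opens.comap h (above (r (i + 1)))) ≤
        lowerIntegral (openMass μ) (Opens.comap h) :=
      le_iSup_of_le n (le_iSup_of_le r (le_iSup_of_le hr le_rfl))
    refine le_trans ?_ (add_le_add_left h1 _)
    rw [lower_sum_eq_lintegral, ← lintegral_const, ← lintegral_add_right _ measurable_const]
    refine lintegral_mono fun x => ?_
    have hx : h x ≤ M := hM ⟨x, rfl⟩
    have := min_le_lower_sum_add (fun i => (r i : ℝ≥0)) ε (h x) n hr.cast_zero hr.cast_le
      fun i _ => hs i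
    rw [min_eq_left (hx.trans hn.le)] at this
    rw [← ENNReal.coe_add]
    exact ENNReal.coe_le_coe.2 this

theorem upperIntegral_comap [IsFiniteMeasure μ] [CompactSpace X] :
    upperIntegral (compl (openMass μ)) (Opens.comap h) = ∫⁻ x, h x ∂μ := by
  apply le_antisymm
  · obtain ⟨M, hM⟩ := (isCompact_range h.continuous).bddAbove
    refine le_of_forall_pos_le_add_mul (measure_ne_top μ Set.univ) fun ε hε => ?_
    obtain ⟨n, r, hr, hn, hs⟩ := exists_uniform_subdivision M ε hε
    have htop : Opens.comap h (below (r n)) = ⊤ := by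
      refine Opens.ext (Set.eq_univ_of_forall fun x => ?_)
      exact lt_of_le_of_lt (hM ⟨x, rfl⟩) hn
    have h1 : upperIntegral (compl (openMass μ)) (Opens.comap h) ≤
        ∑ i ∈ Finset.range n, step r i * compl (openMass μ) (Opens.comap h (below (r i))) :=
      iInf_le_of_le n (iInf_le_of_le r (iInf_le_of_le hr (iInf_le_of_le htop le_rfl)))
    refine h1.trans ?_
    rw [upper_sum_eq_lintegral, ← lintegral_const, ← lintegral_add_right _ measurable_const]
    refine lintegral_mono fun x => ?_
    have := upper_sum_le_add (fun i => (r i : ℝ≥0)) ε (h x) n hr.cast_le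
      fun i _ => hs i
    rw [← ENNReal.coe_add]
    exact ENNReal.coe_le_coe.2 this
  · refine le_iInf fun n => le_iInf fun r => le_iInf fun hr => le_iInf fun htop => ?_
    rw [upper_sum_eq_lintegral]
    refine lintegral_mono fun x => ENNReal.coe_le_coe.2 ?_
    have hx : h x < r n := by
      have : x ∈ Opens.comap h (below (r n)) := htop ▸ trivial
      exact this
    have := min_le_upper_sum (fun i => (r i : ℝ≥0)) (h x) n hr.cast_zero hr.cast_le
    rwa [min_eq_left hx.le] at this

theorem isIntegralNonneg_comap_iff [IsFiniteMeasure μ] [CompactSpace X] (a : ℝ≥0) :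
    IsIntegralNonneg (openMass μ) (Opens.comap h) a ↔ ∫⁻ x, h x ∂μ = a := by
  rw [IsIntegralNonneg, lowerIntegral_comap, upperIntegral_comap, and_self_iff]

theorem isIntegral_comap_iff [IsFiniteMeasure μ] [CompactSpace X] (k : C(X, ℝ)) (a : ℝ) :
    IsIntegral (openMass μ) (Opens.comap k) a ↔ ∫ x, k x ∂μ = a := by
  have hk : Integrable k μ := k.continuous.integrable_of_hasCompactSupport
    (HasCompactSupport.of_compactSpace _)
  have hp : posPart (Opens.comap k) =
      Opens.comap ((⟨Real.toNNReal, by fun_prop⟩ : C(ℝ, ℝ≥0)).comp k) := rfl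
  have hn : negPart (Opens.comap k) =
      Opens.comap ((⟨fun t => Real.toNNReal (-t), by fun_prop⟩ : C(ℝ, ℝ≥0)).comp k) := rfl
  have hpf : ∫⁻ x, (Real.toNNReal (k x) : ℝ≥0∞) ∂μ ≠ ∞ := hk.lintegral_lt_top.ne
  have hnf : ∫⁻ x, (Real.toNNReal (-k x) : ℝ≥0∞) ∂μ ≠ ∞ := hk.neg.lintegral_lt_top.ne
  rw [integral_eq_lintegral_pos_part_sub_lintegral_neg_part hk, IsIntegral, hp, hn]
  simp only [isIntegralNonneg_comap_iff, ContinuousMap.comp_apply, ContinuousMap.coe_mk]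
  unfold ENNReal.ofReal
  constructor
  · rintro ⟨p, n, h1, h2, rfl⟩
    rw [h1, h2]
    simp
  · rintro rfl
    exact ⟨_, _, (ENNReal.coe_toNNReal hpf).symm, (ENNReal.coe_toNNReal hnf).symm, rfl⟩

end Integrals

/-! ### Lebesgue and uniform valuations as measures -/

section Valuations

variable {x y : ℝ}

theorem mem_trace {a b : ℚ} {t : Set.Icc x y} :
    t ∈ trace x y a b ↔ (a : ℝ) < t ∧ (t : ℝ) < b := Iff.rfl

theorem extend_le_openMass (ν : Measure (Set.Icc x y)) {m : ℚ → ℚ → ℝ≥0∞}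
    (hm : ∀ a b, m a b ≤ ν (trace x y a b)) (U : Opens (Set.Icc x y)) :
    extend x y m U ≤ openMass ν U := by
  refine iSup_le fun S => iSup_le fun hS => iSup_le fun hd => ?_
  refine (Finset.sum_le_sum fun p _ => hm p.1 p.2).trans ?_
  rw [← measure_biUnion_finset]
  · exact measure_mono (Set.iUnion₂_subset fun p hp => (hS p hp).2)
  · intro p hp q hq hpq
    refine Set.disjoint_left.2 fun t htp htq => ?_
    have h1 := mem_trace.1 htp
    have h2 := mem_trace.1 htq
    -- A real point common to both traces forces a rational point common to both intervals, against
    -- their disjointness in `ℚ`.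
    have h3 : max p.1 q.1 < min p.2 q.2 := by
      have : (max (p.1 : ℝ) q.1) < min (p.2 : ℝ) q.2 :=
        (max_lt h1.1 h2.1).trans (lt_min h1.2 h2.2)
      exact_mod_cast this
    obtain ⟨c, hc1, hc2⟩ := exists_between h3
    rw [max_lt_iff] at hc1
    rw [lt_min_iff] at hc2
    exact Set.disjoint_left.1 (hd hp hq hpq) ⟨hc1.1, hc2.1⟩ ⟨hc1.2, hc2.2⟩
  · exact fun p _ => (trace x y p.1 p.2).isOpen.measurableSet

/-- Lebesgue measure on the compact interval `[x, y]`. -/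
noncomputable def lebesgueMeasure (x y : ℝ) : Measure (Set.Icc x y) :=
  Measure.comap (↑) (volume : Measure ℝ)

theorem lebesgueMeasure_apply (s : Set (Set.Icc x y)) :
    lebesgueMeasure x y s = volume ((↑) '' s : Set ℝ) :=
  comap_subtype_coe_apply measurableSet_Icc volume s

theorem lebesgueMeasure_univ : lebesgueMeasure x y Set.univ = ENNReal.ofReal (y - x) := by
  rw [lebesgueMeasure_apply, Set.image_univ, Subtype.range_coe, Real.volume_Icc]

instance : IsFiniteMeasure (lebesgueMeasure x y) :=
  ⟨lebesgueMeasure_univ.trans_lt ENNReal.ofReal_lt_top⟩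

theorem lebesgueMeasure_trace (a b : ℚ) :
    lebesgueMeasure x y (trace x y a b) = lebesgueMass x y a b := by
  rw [lebesgueMeasure_apply]
  have h : ((↑) '' (trace x y a b : Set (Set.Icc x y)) : Set ℝ) =
      Set.Ioo (a : ℝ) b ∩ Set.Icc x y := by
    ext t
    constructor
    · rintro ⟨t, ht, rfl⟩
      exact ⟨ht, t.2⟩
    · rintro ⟨h1, h2⟩
      exact ⟨⟨t, h2⟩, h1, rfl⟩
  rw [h, lebesgueMass]
  -- The intersection lies between the open and the closed interval with the same endpoints, which
  -- have equal measure.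
  apply le_antisymm
  · refine (measure_mono (t := Set.Icc (max (a : ℝ) x) (min (b : ℝ) y)) fun t ht => ?_).trans
      Real.volume_Icc.le
    exact ⟨max_le ht.1.1.le ht.2.1, le_min ht.1.2.le ht.2.2⟩
  · rw [← Real.volume_Ioo]
    refine measure_mono fun t ht => ?_
    have h1 := max_lt_iff.1 ht.1
    have h2 := lt_min_iff.1 ht.2
    exact ⟨⟨h1.1, h2.1⟩, h1.2.le, h2.2.le⟩

theorem disjoint_Ioo_div (N : ℕ) {i j : ℤ} (hij : i ≠ j) :
    Disjoint (Set.Ioo ((i : ℚ) / (N + 1)) ((i + 1) / (N + 1)))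
      (Set.Ioo ((j : ℚ) / (N + 1)) ((j + 1) / (N + 1))) := by
  have hN : (0 : ℚ) < N + 1 := by positivity
  refine Set.disjoint_left.2 fun t hi hj => hij ?_
  have h1 := (div_lt_iff₀ hN).1 hi.1
  have h2 := (lt_div_iff₀ hN).1 hi.2
  have h3 := (div_lt_iff₀ hN).1 hj.1
  have h4 := (lt_div_iff₀ hN).1 hj.2
  have h5 : (i : ℚ) < j + 1 := h1.trans h4
  have h6 : (j : ℚ) < i + 1 := h3.trans h2
  norm_cast at h5 h6
  omega

/-- For the hard inequality, `U` is approximated from inside by a compact `K`, which has a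
thickening inside `U`. The cells of a sufficiently fine rational grid that lie in `U` cover `K` up
to grid points, a null set. -/
theorem lebesgue_eq_openMass (x y : ℝ) :
    lebesgue x y = openMass (lebesgueMeasure x y) := by
  funext U
  refine le_antisymm (extend_le_openMass _ (fun a b => (lebesgueMeasure_trace a b).ge) U) ?_
  refine le_of_forall_lt fun c hc => ?_
  obtain ⟨K, hKU, hK, hcK⟩ := U.isOpen.exists_lt_isCompact hc
  refine hcK.trans_le ?_
  obtain ⟨δ, hδ, hthick⟩ := hK.exists_thickening_subset_open U.isOpen hKU
  obtain ⟨N, hN⟩ := exists_nat_one_div_lt hδ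
  have hN0 : (0 : ℝ) < N + 1 := by positivity
  classical
  let P : ℤ → ℚ × ℚ := fun i => ((i : ℚ) / (N + 1), ((i : ℚ) + 1) / (N + 1))
  have hP : Function.Injective P := by
    intro i j hij
    have h := (Prod.ext_iff.1 hij).1
    simp only [P] at h
    have : (N : ℚ) + 1 ≠ 0 := by positivity
    field_simp at h
    exact_mod_cast h
  let J : Finset ℤ := (Finset.Icc ⌊x * (N + 1)⌋ ⌊y * (N + 1)⌋).filter
    fun i => trace x y (P i).1 (P i).2 ≤ U
  have hle : ∑ p ∈ J.image P, lebesgueMass x y p.1 p.2 ≤ lebesgue x y U := by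
    refine le_iSup_of_le (J.image P) (le_iSup_of_le ?_ (le_iSup_of_le ?_ le_rfl))
    · intro p hp
      obtain ⟨i, hi, rfl⟩ := Finset.mem_image.1 hp
      refine ⟨?_, (Finset.mem_filter.1 hi).2⟩
      simp only [P]
      gcongr
      simp
    · rintro p hp q hq hpq
      obtain ⟨i, hi, rfl⟩ := Finset.mem_image.1 hp
      obtain ⟨j, hj, rfl⟩ := Finset.mem_image.1 hq
      exact disjoint_Ioo_div N fun h => hpq (h ▸ rfl)
  refine le_trans ?_ hle
  rw [Finset.sum_image hP.injOn]
  have hcover : K ⊆ (⋃ i ∈ J, (trace x y (P i).1 (P i).2 : Set (Set.Icc x y))) ∪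
      (↑) ⁻¹' (Set.range fun i : ℤ => (i : ℝ) / (N + 1)) := by
    intro t ht
    by_cases hmem : (t : ℝ) ∈ Set.range fun i : ℤ => (i : ℝ) / (N + 1)
    · exact Or.inr hmem
    refine Or.inl ?_
    set i := ⌊(t : ℝ) * (N + 1)⌋ with hi
    have h1 : (i : ℝ) ≤ t * (N + 1) := Int.floor_le _
    have h2 : (t : ℝ) * (N + 1) < i + 1 := Int.lt_floor_add_one _
    have h3 : (i : ℝ) / (N + 1) < t := by
      refine lt_of_le_of_ne ((div_le_iff₀ hN0).2 h1) fun h => hmem ⟨i, h⟩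
    have h4 : (t : ℝ) < (i + 1) / (N + 1) := (lt_div_iff₀ hN0).2 h2
    refine Set.mem_biUnion (x := i) ?_ ?_
    · refine Finset.mem_coe.2 (Finset.mem_filter.2 ⟨Finset.mem_Icc.2 ⟨?_, ?_⟩, ?_⟩)
      · exact Int.floor_le_floor (by gcongr; exact t.2.1)
      · exact Int.floor_le_floor (by gcongr; exact t.2.2)
      · intro s hs
        refine hthick (Metric.mem_thickening_iff.2 ⟨t, ht, ?_⟩)
        have hs := mem_trace.1 hs
        simp only [P] at hs
        push_cast at hs
        rw [add_div] at hs h4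
        rw [Subtype.dist_eq, Real.dist_eq, abs_lt]
        constructor <;> linarith
    · refine mem_trace.2 ?_
      simp only [P]
      push_cast
      exact ⟨h3, h4⟩
  refine (measure_mono hcover).trans ((measure_union_le _ _).trans ?_)
  have hnull : lebesgueMeasure x y
      ((↑) ⁻¹' (Set.range fun i : ℤ => (i : ℝ) / (N + 1))) = 0 := by
    rw [lebesgueMeasure_apply]
    exact measure_mono_null (Set.image_preimage_subset _ _) ((Set.countable_range _).measure_zero volume)
  rw [hnull, add_zero]
  refine (measure_biUnion_finset_le _ _).trans_eq ?_
  exact Finset.sum_congr rfl fun i _ => lebesgueMeasure_trace _ _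

theorem exists_nnrat_btwn {a b : ℝ≥0∞} (hab : a < b) :
    ∃ q : ℚ≥0, a < ((q : ℝ≥0) : ℝ≥0∞) ∧ ((q : ℝ≥0) : ℝ≥0∞) < b := by
  obtain ⟨q, hq, h1, h2⟩ := ENNReal.lt_iff_exists_rat_btwn.1 hab
  lift q to ℚ≥0 using hq
  have h : Real.toNNReal ((q : ℚ) : ℝ) = (q : ℝ≥0) := by
    rw [show ((q : ℚ) : ℝ) = ((q : ℝ≥0) : ℝ) from rfl, Real.toNNReal_coe]
  exact ⟨q, h ▸ h1, h ▸ h2⟩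

theorem iSup_nnratCast_lt (c : ℝ≥0∞) :
    ⨆ (q : ℚ≥0) (_ : ((q : ℝ≥0) : ℝ≥0∞) < c), ((q : ℝ≥0) : ℝ≥0∞) = c := by
  apply le_antisymm
  · exact iSup₂_le fun q hq => hq.le
  · refine le_of_forall_lt fun d hd => ?_
    obtain ⟨q, hdq, hqc⟩ := exists_nnrat_btwn hd
    exact hdq.trans_le (le_iSup₂_of_le q hqc le_rfl)

theorem uniformMass_eq_of_lt (hxy : x < y) (a b : ℚ) :
    uniformMass x y a b = (ENNReal.ofReal (y - x))⁻¹ * lebesgueMass x y a b := by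
  have h0 : ENNReal.ofReal (y - x) ≠ 0 := by simpa using hxy
  have hiff : ∀ q : ℚ≥0, (((q : ℝ≥0) : ℝ≥0∞) * ENNReal.ofReal (y - x) < lebesgueMass x y a b ∨
      ((a : ℝ) < x ∧ y < b ∧ q < 1)) ↔
      ((q : ℝ≥0) : ℝ≥0∞) < (ENNReal.ofReal (y - x))⁻¹ * lebesgueMass x y a b := by
    intro q
    rw [mul_comm (ENNReal.ofReal (y - x))⁻¹, ← div_eq_mul_inv,
      ENNReal.lt_div_iff_mul_lt (Or.inl h0) (Or.inl ENNReal.ofReal_ne_top), or_iff_left_iff_imp]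
    -- When `x < y` the second disjunct is redundant: the interval contains `[x, y]`, so its
    -- Lebesgue mass is `y - x`.
    rintro ⟨ha, hb, hq⟩
    rw [lebesgueMass, min_eq_right hb.le, max_eq_right ha.le]
    have hq' : ((q : ℝ≥0) : ℝ≥0∞) < 1 := by
      rw [← ENNReal.coe_one, ENNReal.coe_lt_coe]
      exact_mod_cast hq
    simpa using ENNReal.mul_lt_mul_left h0 ENNReal.ofReal_ne_top hq'
  unfold uniformMass
  simp_rw [hiff]
  exact iSup_nnratCast_lt _

/-- Over one point the Lebesgue disjunct reads `0 < 0`, so only the second disjunct contributes. -/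
theorem uniformMass_self (x : ℝ) (a b : ℚ) :
    uniformMass x x a b = if (a : ℝ) < x ∧ x < b then 1 else 0 := by
  have hle : min (b : ℝ) x - max (a : ℝ) x ≤ 0 :=
    sub_nonpos.2 ((min_le_right _ _).trans (le_max_right _ _))
  unfold uniformMass lebesgueMass
  simp only [sub_self, ENNReal.ofReal_zero, mul_zero, ENNReal.ofReal_of_nonpos hle, lt_irrefl,
    false_or]
  split_ifs with h
  · convert iSup_nnratCast_lt 1 using 4 with q
    rw [← ENNReal.coe_one, ENNReal.coe_lt_coe]
    simp only [h.1, h.2, true_and]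
    norm_cast
  · refine le_antisymm (iSup₂_le fun q hq => absurd ⟨hq.1, hq.2.1⟩ h) zero_le

theorem uniform_eq_of_lt (hxy : x < y) :
    uniform x y = openMass ((ENNReal.ofReal (y - x))⁻¹ • lebesgueMeasure x y) := by
  funext U
  have h := congrFun (lebesgue_eq_openMass x y) U
  rw [openMass, Measure.smul_apply, smul_eq_mul]
  rw [openMass] at h
  rw [← h]
  simp only [uniform, lebesgue, extend, uniformMass_eq_of_lt hxy, ← Finset.mul_sum,
    ENNReal.mul_iSup]

theorem uniform_self (x : ℝ) :
    uniform x x = openMass (Measure.dirac (⟨x, le_rfl, le_rfl⟩ : Set.Icc x x)) := by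
  have huniq : ∀ t : Set.Icc x x, t = ⟨x, le_rfl, le_rfl⟩ := fun t =>
    Subtype.ext (le_antisymm t.2.2 t.2.1)
  funext U
  apply le_antisymm
  · refine extend_le_openMass _ (fun a b => ?_) U
    rw [uniformMass_self, Measure.dirac_apply' _ (trace x x a b).isOpen.measurableSet]
    split_ifs with h
    · have hx : (⟨x, le_rfl, le_rfl⟩ : Set.Icc x x) ∈ trace x x a b := h
      exact (Set.indicator_of_mem (SetLike.mem_coe.2 hx) 1).ge
    · exact zero_le
  · rw [openMass, Measure.dirac_apply' _ U.isOpen.measurableSet]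
    refine Set.indicator_apply_le' (fun hx => ?_) fun _ => zero_le
    obtain ⟨a, ha⟩ := exists_rat_lt x
    obtain ⟨b, hb⟩ := exists_rat_gt x
    refine le_iSup_of_le {(a, b)} (le_iSup_of_le ?_ (le_iSup_of_le ?_ ?_))
    · intro p hp
      obtain rfl := Finset.mem_singleton.1 hp
      refine ⟨by exact_mod_cast ha.trans hb, fun t _ => ?_⟩
      rw [huniq t]
      exact hx
    · simp
    · rw [Finset.sum_singleton, uniformMass_self, if_pos ⟨ha, hb⟩]
      rfl

theorem integral_lebesgueMeasure (hxy : x ≤ y) (k : ℝ → ℝ) :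
    ∫ t, k t ∂lebesgueMeasure x y = ∫ t in x..y, k t := by
  rw [lebesgueMeasure, integral_subtype_comap measurableSet_Icc, integral_Icc_eq_integral_Ioc,
    intervalIntegral.integral_of_le hxy]

/-- The affine parametrisation of `[x, y]` by `[0, 1]` covers the degenerate case too, where it is
constant and matches the Dirac measure. -/
theorem exists_measure_uniform (hxy : x ≤ y) :
    ∃ ν : Measure (Set.Icc x y), IsProbabilityMeasure ν ∧ uniform x y = openMass ν ∧
      ∀ k : ℝ → ℝ, ∫ t, k t ∂ν = ∫ t in (0 : ℝ)..1, k (x + (y - x) * t) := by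
  obtain rfl | hxy := hxy.eq_or_lt
  · refine ⟨_, inferInstance, uniform_self x, fun k => ?_⟩
    simp
  · refine ⟨_, ⟨?_⟩, uniform_eq_of_lt hxy, fun k => ?_⟩
    · rw [Measure.smul_apply, smul_eq_mul, lebesgueMeasure_univ]
      exact ENNReal.inv_mul_cancel (by simpa using hxy) ENNReal.ofReal_ne_top
    · rw [integral_smul_measure, integral_lebesgueMeasure hxy.le,
        intervalIntegral.integral_comp_add_mul _ (sub_pos.2 hxy).ne']
      simp [ENNReal.toReal_inv, ENNReal.toReal_ofReal (sub_pos.2 hxy).le]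

end Valuations

/-! ### Mean values, slope map and derivative -/

section FundamentalTheorem

variable {I : Opens ℝ} (hI : (I : Set ℝ).OrdConnected) (G : C(I, ℝ))

/-- The extension by zero to `ℝ` of a continuous function on `I`. -/
noncomputable def zeroExtend : ℝ → ℝ := Function.extend (↑) G 0

theorem zeroExtend_coe (t : I) : zeroExtend G t = G t :=
  Subtype.val_injective.extend_apply G 0 t

theorem continuousOn_zeroExtend : ContinuousOn (zeroExtend G) I := by
  rw [continuousOn_iff_continuous_domRestrict]
  exact G.continuous.congr fun t => (zeroExtend_coe G t).symm

theorem intervalIntegrable_zeroExtend (hI : (I : Set ℝ).OrdConnected) (x y : I) :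
    IntervalIntegrable (zeroExtend G) volume x y :=
  ((continuousOn_zeroExtend G).mono (hI.uIcc_subset x.2 y.2)).intervalIntegrable

/-- The mean value of `G` between `x` and `y`, namely `∫₀¹ G(x + t(y - x)) dt`. -/
noncomputable def mean : C(I × I, ℝ) where
  toFun p := ∫ t in (0 : ℝ)..1, zeroExtend G
    (p.1 + (p.2 - p.1) * (Set.projIcc (0 : ℝ) 1 zero_le_one t : ℝ))
  continuous_toFun := by
    -- Projecting `t` to `[0, 1]` keeps the argument in `I` for every real `t`, by convexity, so the
    -- integrand is continuous everywhere.
    refine intervalIntegral.continuous_parametric_intervalIntegral_of_continuous' ?_ 0 1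
    refine (continuousOn_zeroExtend G).comp_continuous (by fun_prop) fun p => ?_
    have := hI.convex.add_smul_sub_mem p.1.1.2 p.1.2.2
      (Set.projIcc (0 : ℝ) 1 zero_le_one p.2).2
    rwa [smul_eq_mul, mul_comm] at this

theorem mean_apply (x y : I) :
    mean hI G (x, y) = ∫ t in (0 : ℝ)..1, zeroExtend G (x + (y - x) * t) := by
  refine intervalIntegral.integral_congr fun t ht => ?_
  rw [Set.uIcc_of_le zero_le_one] at ht
  simp only [Set.projIcc_of_mem _ ht]

/-- Substitution of `1 - t` for `t`. The symmetry allows the endpoints to be sorted. -/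
theorem mean_swap (x y : I) : mean hI G (x, y) = mean hI G (y, x) := by
  rw [mean_apply, mean_apply]
  have := intervalIntegral.integral_comp_sub_left
    (fun t => zeroExtend G (x + (y - x) * t)) (a := 0) (b := 1) 1
  rw [sub_self, sub_zero] at this
  rw [← this]
  congr 1
  funext t
  ring_nf

theorem mean_min_max (x y : I) : mean hI G (min x y, max x y) = mean hI G (x, y) := by
  obtain h | h := le_total x y
  · rw [min_eq_left h, max_eq_right h]
  · rw [min_eq_right h, max_eq_left h, mean_swap]

theorem mean_self (x : I) : mean hI G (x, x) = G x := by
  rw [mean_apply]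
  simp [zeroExtend_coe]

theorem sub_mul_mean (x y : I) :
    ((y : ℝ) - x) * mean hI G (x, y) = ∫ t in (x : ℝ)..y, zeroExtend G t := by
  rw [mean_apply, ← smul_eq_mul, intervalIntegral.smul_integral_comp_add_mul]
  ring_nf

/-- The indefinite integral `x ↦ ∫_{x₀}^x G(t) dt`. -/
noncomputable def indefiniteIntegral (x₀ : I) : C(I, ℝ) where
  toFun x := ∫ t in (x₀ : ℝ)..x, zeroExtend G t
  continuous_toFun := by
    -- Continuity is inherited from `mean`, through the factorisation `(x - x₀) * mean (x₀, x)`.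
    simp_rw [← sub_mul_mean hI]
    fun_prop

theorem indefiniteIntegral_sub (x₀ x y : I) :
    indefiniteIntegral hI G x₀ y - indefiniteIntegral hI G x₀ x =
      ((y : ℝ) - x) * mean hI G (x, y) := by
  rw [sub_mul_mean]
  exact intervalIntegral.integral_interval_sub_left
    (intervalIntegrable_zeroExtend G hI x₀ y) (intervalIntegrable_zeroExtend G hI x₀ x)

theorem isIntegral_restrict_iff (x y : I) (ν : Measure (Set.Icc (x : ℝ) y)) [IsFiniteMeasure ν]
    (a : ℝ) : IsIntegral (openMass ν) (restrict hI (Opens.comap G) x y) a ↔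
      ∫ t, zeroExtend G t ∂ν = a := by
  have h : restrict hI (Opens.comap G) x y = Opens.comap (G.comp (inclusion hI x y)) := rfl
  rw [h, isIntegral_comap_iff]
  refine Eq.congr_left (integral_congr_ae (.of_forall fun t => ?_))
  exact (zeroExtend_coe G (inclusion hI x y t)).symm

theorem isRiemannIntegral_iff (x y : I) (a : ℝ) :
    IsRiemannIntegral hI (Opens.comap G) x y a ↔ ∫ t in (x : ℝ)..y, zeroExtend G t = a := by
  have key : ∀ (x y : I) (a : ℝ), x ≤ y → (IsIntegral (lebesgue x y)
      (restrict hI (Opens.comap G) x y) a ↔ ∫ t in (x : ℝ)..y, zeroExtend G t = a) := by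
    intro x y a h
    rw [lebesgue_eq_openMass, isIntegral_restrict_iff, integral_lebesgueMeasure h]
  have hneg : ∫ t in (y : ℝ)..x, zeroExtend G t = -a ↔
      ∫ t in (x : ℝ)..y, zeroExtend G t = a := by
    rw [intervalIntegral.integral_symm, neg_inj]
  constructor
  · rintro ⟨h1, h2⟩
    obtain h | h := le_total x y
    · exact (key x y a h).1 (h1 h)
    · exact hneg.1 ((key y x _ h).1 (h2 h))
  · exact fun h => ⟨fun hxy => (key x y a hxy).2 h, fun hyx => (key y x _ hyx).2 (hneg.2 h)⟩

/-- The integral at each point has exactly one value, and a map is determined by its values at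
points; existence and uniqueness both follow. -/
theorem isIndefiniteIntegral_iff (x₀ : I) (f : LMap I ℝ) :
    IsIndefiniteIntegral hI (Opens.comap G) x₀ f ↔
      f = Opens.comap (indefiniteIntegral hI G x₀) := by
  obtain ⟨F, rfl⟩ := f.exists_eq_comap
  simp only [IsIndefiniteIntegral, isRiemannIntegral_iff, hasValue_comap_iff]
  constructor
  · intro h
    congr 1
    ext x
    obtain ⟨a, ha, hF⟩ := h x
    exact hF.trans ha.symm
  · intro h x
    exact ⟨_, rfl, (hasValue_comap_iff F x _).1 (h ▸ (hasValue_comap_iff _ x _).2 rfl)⟩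

theorem hasDerivativeVia_mean (x₀ : I) :
    HasDerivativeVia (Opens.comap (indefiniteIntegral hI G x₀)) (Opens.comap G)
      (Opens.comap (mean hI G)) := by
  refine ⟨?_, ?_⟩
  · rw [IsSlope, ← Opens.comap_comp, ← Opens.comap_comp, binop_comap, binop_comap, binop_comap]
    congr 2
    ext ⟨x, y⟩
    exact indefiniteIntegral_sub hI G x₀ x y
  · rw [diagonal, ← Opens.comap_comp]
    congr 1
    ext x
    exact mean_self hI G x

end FundamentalTheorem

end PointFree

theorem theorem4p1 (I : TopologicalSpace.Opens ℝ) (hI : (I : Set ℝ).OrdConnected)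
    (g : PointFree.LMap I ℝ) (x₀ : I) :
    (∃! f : PointFree.LMap I ℝ, PointFree.IsIndefiniteIntegral hI g x₀ f) ∧
    ∀ f : PointFree.LMap I ℝ, PointFree.IsIndefiniteIntegral hI g x₀ f →
      ∃ s : PointFree.LMap (I × I) ℝ,
        PointFree.HasDerivativeVia f g s ∧
        ∀ x y : I,
          PointFree.IsProbabilityValuation
            (PointFree.uniform (min x y : I) (max x y : I)) ∧
          ∃ a : ℝ,
            PointFree.IsIntegral (PointFree.uniform (min x y : I) (max x y : I))
              (PointFree.restrict hI g (min x y) (max x y)) a ∧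
            s.HasValue (x, y) a := by
  obtain ⟨G, rfl⟩ := g.exists_eq_comap
  simp only [PointFree.isIndefiniteIntegral_iff]
  refine ⟨⟨_, rfl, fun f hf => hf⟩, ?_⟩
  rintro f rfl
  refine ⟨_, PointFree.hasDerivativeVia_mean hI G x₀, fun x y => ?_⟩
  obtain ⟨ν, hν, hu, hint⟩ := PointFree.exists_measure_uniform
    (x := (min x y : I)) (y := (max x y : I)) (min_le_max : min x y ≤ max x y)
  rw [hu]
  refine ⟨⟨PointFree.isValuation_openMass ν, MeasureTheory.measure_univ⟩, _,
    (PointFree.isIntegral_restrict_iff hI G _ _ ν _).2 rfl, ?_⟩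
  rw [PointFree.hasValue_comap_iff, hint, ← PointFree.mean_apply hI, PointFree.mean_min_max]
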